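/- Let $J'$ be a bounded selfadjoint Jacobi operator on $\ell^2(\mathbb Z)$, i.e. a bounded selfadjoint operator represented in the standard basis $(\delta_n)_{n\in\mathbb Z}$ by a two-sided tridiagonal matrix. Let $p\ge 1$ be real and let $D\ge 0$ be an operator on $\ell^2(\mathbb Z)$, diagonal in the standard basis, of Schatten class $\mathcal S_p$, where $\|T\|_p=(\operatorname{tr}|T|^p)^{1/p}$. Let $d\rho_n$ be the spectral measure of $(J',\delta_n)$. Then for every $n\in\mathbb Z$ $$\bigl\langle\delta_n,(J'-z)^{-1}\delta_n\bigr\rangle=\int_{\sigma(J')}\frac{d\rho_n(t)}{t-z},\qquad z\in\mathbb C\setminus\sigma(J'),$$ and for every $z\in\mathbb C\setminus\sigma(J')$ the operator $D^{1/2}(J'-z)^{-1}D^{1/2}$ belongs to $\mathcal S_p$ and $$\bigl\|D^{1/2}(J'-z)^{-1}D^{1/2}\bigr\|_p^p\le\frac{\sqrt2\,\|D\|_p^p}{\operatorname{dist}(z,\sigma(J'))^{p-1}}\;\sup_{n\in\mathbb Z}\int_{\sigma(J')}\frac{d\rho_n(t)}{|t-z|}.$$ -/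

import Mathlib

open scoped ENNReal CompactlySupported

noncomputable section

namespace JacobiSchatten

section Hilbert

variable {H : Type*} [NormedAddCommGroup H] [InnerProductSpace ℂ H]

/-- The inverse `(A - z)⁻¹`; it is a genuine inverse for `z` outside the spectrum of `A`. -/
def resolventOp (A : H →L[ℂ] H) (z : ℂ) : H →L[ℂ] H :=
  Ring.inverse (A - z • (1 : H →L[ℂ] H))

/-- The real points of the spectrum of `A`.  For selfadjoint `A` this is the whole spectrum,
viewed as a subset of the line. -/
def realSpectrum (A : H →L[ℂ] H) : Set ℝ := {t : ℝ | (t : ℂ) ∈ spectrum ℂ A}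

variable [CompleteSpace H]

/-- The operator `|T|^p`, the power of `|T| = (T* T)^(1/2)` in the functional calculus. -/
def absPow (T : H →L[ℂ] H) (p : ℝ) : H →L[ℂ] H := CFC.abs T ^ p

/-- The nonnegative square root `D^(1/2)` of a nonnegative bounded operator `D`. -/
def posSqrt (D : H →L[ℂ] H) : H →L[ℂ] H := CFC.sqrt D

/-- The positive linear functional `f ↦ ⟨v, f(A) v⟩` on compactly supported continuous functions
on the line, where `f(A)` is given by the continuous functional calculus of the selfadjoint
operator `A`. -/
def spectralFunctional (A : H →L[ℂ] H) (v : H) : C_c(ℝ, ℝ) →ₚ[ℝ] ℝ :=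
  PositiveLinearMap.mk₀
    { toFun := fun f => (inner ℂ v ((cfc (f : ℝ → ℝ) A) v)).re
      map_add' := by
        intro f g
        have h : cfc ((f + g : C_c(ℝ, ℝ)) : ℝ → ℝ) A
            = cfc (f : ℝ → ℝ) A + cfc (g : ℝ → ℝ) A :=
          cfc_add A (f : ℝ → ℝ) (g : ℝ → ℝ) f.continuous.continuousOn
            g.continuous.continuousOn
        rw [h]
        simp
      map_smul' := by
        intro r f
        have h : cfc ((r • f : C_c(ℝ, ℝ)) : ℝ → ℝ) A = r • cfc (f : ℝ → ℝ) A :=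
          cfc_smul (R := ℝ) r (f : ℝ → ℝ) A f.continuous.continuousOn
        rw [h, RingHom.id_apply, smul_apply, ← Complex.coe_smul r,
          inner_smul_right, Complex.re_ofReal_mul, smul_eq_mul] }
    (by
      intro f hf
      have h : (0 : H →L[ℂ] H) ≤ cfc (f : ℝ → ℝ) A := cfc_nonneg fun x _ => hf x
      rw [ContinuousLinearMap.nonneg_iff_isPositive] at h
      exact h.re_inner_nonneg_right v)

/-- The spectral measure of `(A, v)` for selfadjoint `A`: the Borel measure `ρ` on the line,
provided by the Riesz representation theorem, with `∫ f dρ = ⟨v, f(A) v⟩` for all continuous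
compactly supported `f`. -/
def spectralMeasure (A : H →L[ℂ] H) (v : H) : MeasureTheory.Measure ℝ :=
  RealRMK.rieszMeasure (spectralFunctional A v)

end Hilbert

/-- The Hilbert space `ℓ²(ℤ)` of square summable complex two-sided sequences. -/
abbrev Ell2 : Type := lp (fun _ : ℤ => ℂ) 2

/-- The standard basis vector `δ_n` of `ℓ²(ℤ)`. -/
def delta (n : ℤ) : Ell2 := lp.single 2 n (1 : ℂ)

/-- A bounded operator on `ℓ²(ℤ)` is a Jacobi operator if it is represented by a two-sided
tridiagonal matrix with entries `a (n-1)`, `b n`, `c n` in row `n` and columns `n-1`, `n`, `n+1`.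
The parameters are complex; they are bounded because the operator is. -/
def IsJacobi (J : Ell2 →L[ℂ] Ell2) : Prop :=
  ∃ a b c : ℤ → ℂ, ∀ (u : Ell2) (n : ℤ),
    J u n = a (n - 1) * u (n - 1) + b n * u n + c n * u (n + 1)

/-- A bounded operator on `ℓ²(ℤ)` is diagonal if its matrix in the standard basis is diagonal. -/
def IsDiagonal (D : Ell2 →L[ℂ] Ell2) : Prop :=
  ∃ d : ℤ → ℂ, ∀ (u : Ell2) (n : ℤ), D u n = d n * u n

/-- The Schatten norm `‖T‖_p = (tr |T|^p)^(1/p)`, with values in `[0, ∞]`.  The trace of a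
nonnegative operator is the sum of its diagonal matrix entries. -/
def schattenNorm (p : ℝ) (T : Ell2 →L[ℂ] Ell2) : ℝ≥0∞ :=
  (∑' n : ℤ, ENNReal.ofReal (inner ℂ (delta n) (absPow T p (delta n))).re) ^ (1 / p)

/-- Membership in the Schatten class `S_p`. -/
def MemSchatten (p : ℝ) (T : Ell2 →L[ℂ] Ell2) : Prop :=
  schattenNorm p T < ∞

end JacobiSchatten

end

open JacobiSchatten

/-! Write `R` for the resolvent, `r t = 1/(t - z)`, and `C = |r|^(1/2)(J')`. Since `r` has no zeros
on the spectrum, `R = C U C` with `U` an isometry, so `|⟨x, R y⟩| ≤ ‖C x‖ ‖C y‖`. Moreover `‖C‖² ≤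
1/dist(z, σ(J'))`, and `‖C δ_n‖²` is the integral of `1/|t - z|` against the spectral measure of
`δ_n`. It remains to bound `‖S R S‖_p^p`, `S = D^(1/2)`, by `‖C‖^(2(p-1)) ∑ d_n^p ‖C δ_n‖²`.

For `S` cut off to finitely many coordinates, each nonzero singular value of `T = S R S` is `⟨f, T
e⟩ ≤ ‖C S f‖ ‖C S e‖` with singular vectors `e`, `f`. The arithmetic-geometric mean inequality
reduces the claim to bounding `∑ ‖C S e_k‖^(2p)` over an orthonormal family
(`sum_rpow_norm_comp_finiteDiagSqrt_le`). Jensen's inequality, used twice, does this: first in an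
eigenbasis of `S C² S`, then in the basis `δ_n` after passing to `C S² C`, which has the same
nonzero eigenvalues.

The cutoffs converge in norm because the entries of `D` tend to zero. Continuity of `|T|^p` in `T`
carries the bound, uniform in the cutoff, to every partial sum of the trace (`tsum_absPow_le`). -/

noncomputable section

namespace JacobiSchatten

/-! ### Singular values and trace inequalities in finite rank -/

section FiniteRank

variable {H : Type*} [NormedAddCommGroup H] [InnerProductSpace ℂ H]

/-- Jensen's inequality for the power `p` and weights of total mass at most `β`. -/
theorem rpow_sum_mul_le {ι : Type*} (s : Finset ι) {p β : ℝ} (hp : 1 ≤ p) {w f : ι → ℝ}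
    (hw : ∀ i, 0 ≤ w i) (hf : ∀ i, 0 ≤ f i) (hβ : ∑ i ∈ s, w i ≤ β) :
    (∑ i ∈ s, w i * f i) ^ p ≤ β ^ (p - 1) * ∑ i ∈ s, w i * f i ^ p := by
  have hp0 : 0 < p := by linarith
  have hW : 0 ≤ ∑ i ∈ s, w i := Finset.sum_nonneg fun i _ => hw i
  have hX : 0 ≤ ∑ i ∈ s, w i * f i ^ p :=
    Finset.sum_nonneg fun i _ => mul_nonneg (hw i) (Real.rpow_nonneg (hf i) p)
  have h := Real.inner_le_weight_mul_Lp_of_nonneg s hp w f hw hf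
  calc (∑ i ∈ s, w i * f i) ^ p
      ≤ ((∑ i ∈ s, w i) ^ (1 - p⁻¹) * (∑ i ∈ s, w i * f i ^ p) ^ p⁻¹) ^ p :=
        Real.rpow_le_rpow (Finset.sum_nonneg fun i _ => mul_nonneg (hw i) (hf i)) h hp0.le
    _ = (∑ i ∈ s, w i) ^ (p - 1) * ∑ i ∈ s, w i * f i ^ p := by
        rw [Real.mul_rpow (Real.rpow_nonneg hW _) (Real.rpow_nonneg hX _), ← Real.rpow_mul hW,
          ← Real.rpow_mul hX, inv_mul_cancel₀ hp0.ne', Real.rpow_one]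
        congr 2
        field_simp
    _ ≤ β ^ (p - 1) * ∑ i ∈ s, w i * f i ^ p := by
        gcongr

/-- The continuous functional calculus acts on eigenvectors through the eigenvalue. -/
theorem cfc_apply_of_apply_eq_smul [CompleteSpace H] {A : H →L[ℂ] H} (hA : IsSelfAdjoint A)
    {f : ℝ → ℝ} (hf : ContinuousOn f (spectrum ℝ A)) {μ : ℝ} {v : H}
    (hv : A v = (μ : ℂ) • v) : cfc f A v = (f μ : ℂ) • v := by
  rcases eq_or_ne v 0 with rfl | hv0
  · simp
  have hμ : μ ∈ spectrum ℝ A := by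
    rw [spectrum.mem_iff]
    rintro ⟨u, hu⟩
    have h0 : (u : H →L[ℂ] H) v = 0 := by
      rw [hu]
      simp [Algebra.algebraMap_eq_smul_one, hv]
    have h1 : ((↑u⁻¹ : H →L[ℂ] H) * (u : H →L[ℂ] H)) v = v := by simp
    rw [mul_apply_eq_comp, h0, map_zero] at h1
    exact hv0 h1.symm
  -- Stone–Weierstrass: constants and the coordinate generate a dense algebra, and both sides are
  -- continuous in `g`.
  have key : ∀ g : C(spectrum ℝ A, ℝ), cfcHom hA g v = ((g ⟨μ, hμ⟩ : ℝ) : ℂ) • v := by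
    intro g
    induction g using ContinuousMap.induction_on_of_compact with
    | const r =>
      have : cfcHom hA (ContinuousMap.const _ r) = algebraMap ℝ (H →L[ℂ] H) r :=
        AlgHomClass.commutes (cfcHom hA) r
      rw [this]
      simp [Algebra.algebraMap_eq_smul_one]
    | id => rw [cfcHom_id hA]; simpa using hv
    | star_id => rw [star_trivial, cfcHom_id hA]; simpa using hv
    | add g k hg hk => simp [map_add, hg, hk, add_smul]
    | mul g k hg hk =>
      rw [map_mul, mul_apply_eq_comp, hk, map_smul, hg, smul_smul]
      simp [mul_comm]
    | frequently g h =>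
      refine h.mem_of_closed (isClosed_eq ?_ ?_)
      · exact (ContinuousLinearMap.apply ℂ H v).continuous.comp (cfcHom_continuous hA)
      · exact (Complex.continuous_ofReal.comp (continuous_eval_const _)).smul
          continuous_const
  rw [cfc_apply f A hA hf, key]
  rfl

/-- A selfadjoint operator with range in a finite dimensional subspace `V` is diagonalized by an
orthonormal basis of `V`. -/
theorem exists_orthonormal_eigenvectors [CompleteSpace H] {A : H →L[ℂ] H} (hA : IsSelfAdjoint A)
    (V : Submodule ℂ H) [FiniteDimensional ℂ V] (hV : ∀ x, A x ∈ V) :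
    ∃ (m : ℕ) (e : Fin m → H) (μ : Fin m → ℝ), Orthonormal ℂ e ∧
      (∀ k, A (e k) = (μ k : ℂ) • e k) ∧ ∀ v ∈ V, v = ∑ k, inner ℂ (e k) v • e k := by
  have hsym : (A : H →ₗ[ℂ] H).IsSymmetric := hA.isSymmetric
  have hres := hsym.restrict_invariant (V := V) fun x _ => hV x
  let b := hres.eigenvectorBasis rfl
  refine ⟨_, fun k => (b k : H), hres.eigenvalues rfl, ?_, ?_, ?_⟩
  · exact b.orthonormal.comp_linearIsometry V.subtypeₗᵢ
  · intro k
    have := congrArg (Subtype.val) (hres.apply_eigenvectorBasis rfl k)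
    rw [Submodule.coe_smul] at this
    exact this
  · intro v hv
    have := congrArg (Subtype.val) (b.sum_repr' ⟨v, hv⟩)
    simpa using this.symm

/-- Expansion of a vector along eigenvectors: the diagonal matrix entry of a function of `A`. -/
theorem inner_eq_sum_of_eigenvectors {m : ℕ} {e : Fin m → H} {ν : Fin m → ℝ} {B : H →L[ℂ] H}
    (hB : ∀ k, B (e k) = (ν k : ℂ) • e k) {v : H} (hv : v = ∑ k, inner ℂ (e k) v • e k) :
    (inner ℂ v (B v)).re = ∑ k, ‖inner ℂ (e k) v‖ ^ 2 * ν k := by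
  have h : B v = ∑ k, (inner ℂ (e k) v * ν k) • e k := by
    conv_lhs => rw [hv]
    simp only [map_sum, map_smul, hB, smul_smul]
  rw [h, inner_sum, Complex.re_sum]
  refine Finset.sum_congr rfl fun k _ => ?_
  rw [inner_smul_right, ← inner_conj_symm v (e k), mul_right_comm, Complex.mul_conj,
    Complex.normSq_eq_norm_sq]
  norm_cast

/-- The finite rank operator which is diagonal with entries `√(d i)` at the vectors `δ i`, `i ∈ F`. -/
def finiteDiagSqrt {ι : Type*} (δ : ι → H) (d : ι → ℝ) (F : Finset ι) : H →L[ℂ] H :=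
  ∑ i ∈ F, (√(d i) : ℂ) • (innerSL ℂ (δ i)).smulRight (δ i)

theorem finiteDiagSqrt_apply {ι : Type*} (δ : ι → H) (d : ι → ℝ) (F : Finset ι) (x : H) :
    finiteDiagSqrt δ d F x = ∑ i ∈ F, (√(d i) : ℂ) • (inner ℂ (δ i) x : ℂ) • δ i := by
  simp [finiteDiagSqrt]

theorem sum_norm_inner_sq_le {ι : Type*} {δ : ι → H} (hδ : Orthonormal ℂ δ) (F : Finset ι) (x : H) :
    ∑ i ∈ F, ‖inner ℂ x (δ i)‖ ^ 2 ≤ ‖x‖ ^ 2 := by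
  simpa only [norm_inner_symm] using hδ.sum_inner_products_le (s := F) (x := x)

theorem norm_sq_finiteDiagSqrt_apply {ι : Type*} {δ : ι → H} (hδ : Orthonormal ℂ δ) {d : ι → ℝ}
    (hd : ∀ i, 0 ≤ d i) (F : Finset ι) (x : H) :
    ‖finiteDiagSqrt δ d F x‖ ^ 2 = ∑ i ∈ F, ‖inner ℂ (δ i) x‖ ^ 2 * d i := by
  have h : ((‖finiteDiagSqrt δ d F x‖ ^ 2 : ℝ) : ℂ) =
      ((∑ i ∈ F, ‖inner ℂ (δ i) x‖ ^ 2 * d i : ℝ) : ℂ) := by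
    have h1 := inner_self_eq_norm_sq_to_K (𝕜 := ℂ) (finiteDiagSqrt δ d F x)
    have h2 : finiteDiagSqrt δ d F x = ∑ i ∈ F, ((√(d i) : ℂ) * inner ℂ (δ i) x) • δ i := by
      simp only [finiteDiagSqrt_apply, smul_smul]
    have h3 := hδ.inner_sum (fun i => (√(d i) : ℂ) * inner ℂ (δ i) x)
      (fun i => (√(d i) : ℂ) * inner ℂ (δ i) x) F
    rw [← h2, h1] at h3
    push_cast
    refine h3.trans (Finset.sum_congr rfl fun i _ => ?_)
    rw [← Complex.normSq_eq_conj_mul_self, Complex.normSq_mul, Complex.normSq_ofReal,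
      Real.mul_self_sqrt (hd i), Complex.normSq_eq_norm_sq]
    push_cast
    ring
  exact_mod_cast h

variable [CompleteSpace H]

/-- Expressing `|T|^p` through `T* T` lets eigenvectors and norm limits of `T* T` be used without a
separate square root. -/
theorem absPow_eq_cfc (T : H →L[ℂ] H) {p : ℝ} (hp : 0 < p) :
    absPow T p = cfc (fun x : ℝ => x ^ (p / 2)) (star T * T) := by
  lift p to NNReal using hp.le
  have hp' : 0 < p := by exact_mod_cast hp
  have : 0 < p / 2 := by positivity
  rw [absPow, ← CFC.nnrpow_eq_rpow hp', CFC.abs_nnrpow, CFC.nnrpow_eq_rpow this,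
    CFC.rpow_eq_cfc_real (star_mul_self_nonneg T)]
  simp

theorem inner_star_mul_self (X : H →L[ℂ] H) (x y : H) :
    inner ℂ x ((star X * X) y) = inner ℂ (X x) (X y) := by
  rw [mul_apply_eq_comp, ContinuousLinearMap.star_eq_adjoint,
    ContinuousLinearMap.adjoint_inner_right]

theorem eigenvalue_star_mul_self {X : H →L[ℂ] H} {e : H} (he : ‖e‖ = 1) {μ : ℝ}
    (hμ : (star X * X) e = (μ : ℂ) • e) : μ = ‖X e‖ ^ 2 := by
  have h := inner_star_mul_self X e e
  rw [hμ, inner_smul_right, inner_self_eq_norm_sq_to_K, inner_self_eq_norm_sq_to_K, he] at h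
  have h' : (μ : ℂ) = ((‖X e‖ ^ 2 : ℝ) : ℂ) := by simpa using h
  exact_mod_cast h'

/-- The left singular vectors attached to nonzero singular values are orthonormal. -/
theorem orthonormal_left_singular {κ : Type*} {X : H →L[ℂ] H} {e : κ → H}
    (he : Orthonormal ℂ e) {μ : κ → ℝ} (hμ : ∀ k, (star X * X) (e k) = (μ k : ℂ) • e k) :
    Orthonormal ℂ fun k : {k // 0 < μ k} => (((√(μ k))⁻¹ : ℝ) : ℂ) • X (e k) := by
  classical
  rw [orthonormal_iff_ite]
  rintro ⟨j, hj⟩ ⟨k, hk⟩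
  have hjk := (orthonormal_iff_ite.1 he) j k
  rw [inner_smul_left, inner_smul_right, ← inner_star_mul_self, hμ, inner_smul_right, hjk]
  by_cases h : j = k
  · subst h
    have : (√(μ j))⁻¹ * ((√(μ j))⁻¹ * μ j) = 1 := by
      have h0 : √(μ j) ≠ 0 := (Real.sqrt_pos.2 hj).ne'
      nth_rw 3 [← Real.mul_self_sqrt hj.le]
      field_simp
    simpa using (by exact_mod_cast this :
      (((√(μ j))⁻¹ : ℝ) : ℂ) * ((((√(μ j))⁻¹ : ℝ) : ℂ) * μ j) = 1)
  · simp [h]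

theorem isSelfAdjoint_finiteDiagSqrt {ι : Type*} (δ : ι → H) (d : ι → ℝ) (F : Finset ι) :
    IsSelfAdjoint (finiteDiagSqrt δ d F) := by
  rw [ContinuousLinearMap.isSelfAdjoint_iff_isSymmetric]
  intro x y
  simp only [ContinuousLinearMap.coe_coe, finiteDiagSqrt_apply, sum_inner, inner_sum,
    inner_smul_left, inner_smul_right, inner_conj_symm, Complex.conj_ofReal]
  exact Finset.sum_congr rfl fun i _ => by ring

/-- A trace inequality of Berezin type, tested on an orthonormal family. -/
theorem sum_rpow_norm_comp_finiteDiagSqrt_le {ι κ : Type*} [Fintype κ] {δ : ι → H}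
    (hδ : Orthonormal ℂ δ) {d : ι → ℝ} (hd : ∀ i, 0 ≤ d i) (F : Finset ι) {C : H →L[ℂ] H}
    (hC : IsSelfAdjoint C) {β : ℝ} (hβ : ‖C‖ ^ 2 ≤ β) {p : ℝ} (hp : 1 ≤ p) {e : κ → H}
    (he : Orthonormal ℂ e) :
    ∑ k, (‖C (finiteDiagSqrt δ d F (e k))‖ ^ 2) ^ p ≤
      β ^ (p - 1) * ∑ i ∈ F, d i ^ p * ‖C (δ i)‖ ^ 2 := by
  set S := finiteDiagSqrt δ d F with hSdef
  have hS : IsSelfAdjoint S := isSelfAdjoint_finiteDiagSqrt δ d F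
  set X : H →L[ℂ] H := C * S with hX
  have hXstar : star X = S * C := by rw [hX, star_mul, hS.star_eq, hC.star_eq]
  have hβ0 : 0 ≤ β := (sq_nonneg _).trans hβ
  let V : Submodule ℂ H := Submodule.span ℂ (δ '' (F : Set ι))
  have : FiniteDimensional ℂ V := FiniteDimensional.span_of_finite ℂ (F.finite_toSet.image δ)
  have hSV : ∀ x, S x ∈ V := fun x => by
    rw [hSdef, finiteDiagSqrt_apply]
    exact V.sum_mem fun i hi => V.smul_mem _ (V.smul_mem _
      (Submodule.subset_span ⟨i, hi, rfl⟩))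
  obtain ⟨m, h, lam, hh, hlam, hexp⟩ :=
    exists_orthonormal_eigenvectors (IsSelfAdjoint.star_mul_self X) V fun x => by
      rw [hXstar]; exact hSV _
  have hlam' : ∀ j, lam j = ‖X (h j)‖ ^ 2 := fun j => eigenvalue_star_mul_self (hh.1 j) (hlam j)
  have hlam0 : ∀ j, 0 ≤ lam j := fun j => by rw [hlam']; positivity
  have rpow_norm_le : ∀ k, (‖X (e k)‖ ^ 2) ^ p ≤ ∑ j, ‖inner ℂ (h j) (e k)‖ ^ 2 * lam j ^ p := by
    intro k
    -- The vector `e k` need not lie in `V`; its image under `X* X` does, and only that image is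
    -- expanded.
    have hAe : (star X * X) (e k) = ∑ j, ((lam j : ℂ) * inner ℂ (h j) (e k)) • h j := by
      rw [hexp ((star X * X) (e k)) (by rw [hXstar]; exact hSV _)]
      refine Finset.sum_congr rfl fun j _ => ?_
      rw [inner_star_mul_self, ← inner_conj_symm, ← inner_star_mul_self, hlam, inner_smul_right,
        map_mul, inner_conj_symm, Complex.conj_ofReal]
    have hnorm : ‖X (e k)‖ ^ 2 = ∑ j, ‖inner ℂ (h j) (e k)‖ ^ 2 * lam j := by
      have h1 := inner_star_mul_self X (e k) (e k)
      rw [inner_self_eq_norm_sq_to_K, hAe, inner_sum] at h1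
      have h2 : ((‖X (e k)‖ ^ 2 : ℝ) : ℂ) =
          ((∑ j, ‖inner ℂ (h j) (e k)‖ ^ 2 * lam j : ℝ) : ℂ) := by
        push_cast
        refine h1.symm.trans (Finset.sum_congr rfl fun j _ => ?_)
        rw [inner_smul_right, ← inner_conj_symm (e k) (h j), mul_assoc, Complex.mul_conj,
          Complex.normSq_eq_norm_sq]
        push_cast
        ring
      exact_mod_cast h2
    rw [hnorm]
    have := rpow_sum_mul_le Finset.univ hp (w := fun j => ‖inner ℂ (h j) (e k)‖ ^ 2) (f := lam)
      (β := 1) (fun _ => by positivity) hlam0 ?_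
    · simpa using this
    · simpa [he.1 k] using hh.sum_inner_products_le (s := Finset.univ) (x := e k)
  have sum_le_sum_eigenvalues : ∑ k, (‖X (e k)‖ ^ 2) ^ p ≤ ∑ j, lam j ^ p := by
    refine (Finset.sum_le_sum fun k _ => rpow_norm_le k).trans ?_
    rw [Finset.sum_comm]
    refine Finset.sum_le_sum fun j _ => ?_
    rw [← Finset.sum_mul]
    refine mul_le_of_le_one_left (Real.rpow_nonneg (hlam0 j) p) ?_
    simpa [hh.1 j] using sum_norm_inner_sq_le he Finset.univ (h j)
  have hg := orthonormal_left_singular hh hlam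
  set g : {j // 0 < lam j} → H := fun j => (((√(lam j))⁻¹ : ℝ) : ℂ) • X (h j) with hgdef
  -- On the left singular vectors the diagonal enters linearly: `lam j = ∑ |⟨C δ_i, g_j⟩|² d_i`. The
  -- weights have total mass at most `‖C g_j‖² ≤ β`, which is the source of `β^(p-1)` in Jensen's
  -- inequality.
  have eigenvalue_rpow_le : ∀ j : {j // 0 < lam j},
      lam j ^ p ≤ β ^ (p - 1) * ∑ i ∈ F, ‖inner ℂ (C (δ i)) (g j)‖ ^ 2 * d i ^ p := by
    intro j
    have hSC : S (C (g j)) = ((√(lam j) : ℝ) : ℂ) • h j := by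
      have h0 : √(lam j) ≠ 0 := (Real.sqrt_pos.2 j.2).ne'
      have h1 : (√(lam j))⁻¹ * lam j = √(lam j) := by
        nth_rw 2 [← Real.mul_self_sqrt j.2.le]
        field_simp
      have h2 : S (C (X (h j))) = (lam j : ℂ) • h j := by
        rw [← hlam, hXstar]; rfl
      rw [hgdef]
      simp only [map_smul]
      rw [h2, smul_smul, ← Complex.ofReal_mul, h1]
    have hl : lam j = ∑ i ∈ F, ‖inner ℂ (C (δ i)) (g j)‖ ^ 2 * d i := by
      have h1 := norm_sq_finiteDiagSqrt_apply hδ hd F (C (g j))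
      rw [← hSdef, hSC, norm_smul, hh.1 j, mul_one, Complex.norm_real, Real.norm_eq_abs, sq_abs,
        Real.sq_sqrt j.2.le] at h1
      rw [h1]
      refine Finset.sum_congr rfl fun i _ => ?_
      exact congrArg (fun t : ℂ => ‖t‖ ^ 2 * d i) (hC.isSymmetric (δ i) (g j)).symm
    rw [hl]
    refine rpow_sum_mul_le F hp (fun _ => by positivity) hd ?_
    calc ∑ i ∈ F, ‖inner ℂ (C (δ i)) (g j)‖ ^ 2
        = ∑ i ∈ F, ‖inner ℂ (δ i) (C (g j))‖ ^ 2 := Finset.sum_congr rfl fun i _ =>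
          congrArg (fun t : ℂ => ‖t‖ ^ 2) (hC.isSymmetric (δ i) (g j))
      _ ≤ ‖C (g j)‖ ^ 2 := hδ.sum_inner_products_le (C (g j))
      _ ≤ (‖C‖ * ‖g j‖) ^ 2 := by gcongr; exact C.le_opNorm _
      _ ≤ β := by rwa [hg.1 j, mul_one]
  calc ∑ k, (‖X (e k)‖ ^ 2) ^ p ≤ ∑ j, lam j ^ p := sum_le_sum_eigenvalues
    _ = ∑ j : {j // 0 < lam j}, lam j ^ p := by
        classical
        rw [← Finset.sum_subtype (Finset.univ.filter fun j => 0 < lam j) (by simp)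
          (fun j => lam j ^ p)]
        refine (Finset.sum_filter_of_ne fun j _ hj => ?_).symm
        refine (hlam0 j).lt_of_ne fun h0 => hj ?_
        rw [← h0, Real.zero_rpow (by linarith)]
    _ ≤ ∑ j : {j // 0 < lam j},
          β ^ (p - 1) * ∑ i ∈ F, ‖inner ℂ (C (δ i)) (g j)‖ ^ 2 * d i ^ p :=
        Finset.sum_le_sum fun j _ => eigenvalue_rpow_le j
    _ = β ^ (p - 1) * ∑ i ∈ F,
          (∑ j : {j // 0 < lam j}, ‖inner ℂ (C (δ i)) (g j)‖ ^ 2) * d i ^ p := by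
        rw [← Finset.mul_sum, Finset.sum_comm]
        simp only [Finset.sum_mul]
    -- Bessel's inequality for the orthonormal `g_j`, applied to `C δ_i`.
    _ ≤ β ^ (p - 1) * ∑ i ∈ F, d i ^ p * ‖C (δ i)‖ ^ 2 := by
        refine mul_le_mul_of_nonneg_left (Finset.sum_le_sum fun i _ => ?_)
          (Real.rpow_nonneg hβ0 _)
        rw [mul_comm]
        exact mul_le_mul_of_nonneg_left (sum_norm_inner_sq_le hg Finset.univ (C (δ i)))
          (Real.rpow_nonneg (hd i) p)

/-- The `p`-th Schatten power of a finite rank product `S R S`, `S` diagonal, where the form of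
`R` is dominated by that of `C²`. -/
theorem sum_inner_absPow_le {ι : Type*} {δ : ι → H} (hδ : Orthonormal ℂ δ) {d : ι → ℝ}
    (hd : ∀ i, 0 ≤ d i) (F : Finset ι) {R C : H →L[ℂ] H} (hC : IsSelfAdjoint C)
    (hR : ∀ x y, ‖inner ℂ x (R y)‖ ≤ ‖C x‖ * ‖C y‖) {β : ℝ} (hβ : ‖C‖ ^ 2 ≤ β) {p : ℝ}
    (hp : 1 ≤ p) :
    ∑ i ∈ F, (inner ℂ (δ i)
        (absPow (finiteDiagSqrt δ d F * R * finiteDiagSqrt δ d F) p (δ i))).re ≤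
      β ^ (p - 1) * ∑ i ∈ F, d i ^ p * ‖C (δ i)‖ ^ 2 := by
  set S := finiteDiagSqrt δ d F with hSdef
  have hS : IsSelfAdjoint S := isSelfAdjoint_finiteDiagSqrt δ d F
  set T : H →L[ℂ] H := S * R * S with hT
  have hp0 : 0 < p := by linarith
  let V : Submodule ℂ H := Submodule.span ℂ (δ '' (F : Set ι))
  have : FiniteDimensional ℂ V := FiniteDimensional.span_of_finite ℂ (F.finite_toSet.image δ)
  have hSV : ∀ x, S x ∈ V := fun x => by
    rw [hSdef, finiteDiagSqrt_apply]
    exact V.sum_mem fun i hi => V.smul_mem _ (V.smul_mem _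
      (Submodule.subset_span ⟨i, hi, rfl⟩))
  obtain ⟨m, e, μ, he, hμ, hexp⟩ :=
    exists_orthonormal_eigenvectors (IsSelfAdjoint.star_mul_self T) V fun x => by
      rw [hT, star_mul, star_mul, hS.star_eq]; exact hSV _
  have hμ' : ∀ k, μ k = ‖T (e k)‖ ^ 2 := fun k => eigenvalue_star_mul_self (he.1 k) (hμ k)
  have hμ0 : ∀ k, 0 ≤ μ k := fun k => by rw [hμ']; positivity
  have hcont : Continuous fun x : ℝ => x ^ (p / 2) := Real.continuous_rpow_const (by positivity)
  have hpow : ∀ k, absPow T p (e k) = ((μ k ^ (p / 2) : ℝ) : ℂ) • e k := fun k => by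
    rw [absPow_eq_cfc T hp0]
    exact cfc_apply_of_apply_eq_smul (IsSelfAdjoint.star_mul_self T) hcont.continuousOn (hμ k)
  have hf := orthonormal_left_singular he hμ
  set f : {k // 0 < μ k} → H := fun k => (((√(μ k))⁻¹ : ℝ) : ℂ) • T (e k) with hfdef
  have he' : Orthonormal ℂ fun k : {k // 0 < μ k} => e k :=
    he.comp Subtype.val Subtype.val_injective
  -- The singular value `√(μ k)` equals `⟨f_k, T e_k⟩ = ⟨S f_k, R S e_k⟩`. The form bound on `R` and
  -- `2ab ≤ a² + b²` separate the two orthonormal families.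
  have hbound : ∀ k : {k // 0 < μ k},
      μ k ^ (p / 2) ≤ ((‖C (S (f k))‖ ^ 2) ^ p + (‖C (S (e k))‖ ^ 2) ^ p) / 2 := by
    intro k
    have hs : √(μ k) = ‖T (e k)‖ := by rw [hμ', Real.sqrt_sq (norm_nonneg _)]
    have hs0 : ‖T (e k)‖ ≠ 0 := by rw [← hs]; exact (Real.sqrt_pos.2 k.2).ne'
    have h1 : ‖inner ℂ (f k) (T (e k))‖ = ‖T (e k)‖ := by
      rw [hfdef]
      simp only [inner_smul_left, inner_self_eq_norm_sq_to_K, hs]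
      simp
      field_simp
    have h2 : inner ℂ (f k) (T (e k)) = inner ℂ (S (f k)) (R (S (e k))) :=
      (hS.isSymmetric (f k) (R (S (e k)))).symm
    have h3 : ‖T (e k)‖ ≤ ‖C (S (f k))‖ * ‖C (S (e k))‖ := by
      rw [← h1, h2]; exact hR _ _
    have h4 : μ k ^ (p / 2) = ‖T (e k)‖ ^ p := by
      rw [hμ', ← Real.rpow_natCast, ← Real.rpow_mul (norm_nonneg _)]
      congr 1
      push_cast
      ring
    have h5 : ∀ a : ℝ, 0 ≤ a → (a ^ 2) ^ p = (a ^ p) ^ 2 := fun a ha => by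
      rw [← Real.rpow_natCast, ← Real.rpow_natCast, ← Real.rpow_mul ha, ← Real.rpow_mul ha,
        mul_comm]
    have h6 : ‖T (e k)‖ ^ p ≤ ‖C (S (f k))‖ ^ p * ‖C (S (e k))‖ ^ p := by
      rw [← Real.mul_rpow (norm_nonneg _) (norm_nonneg _)]
      exact Real.rpow_le_rpow (norm_nonneg _) h3 hp0.le
    rw [h4, h5 _ (norm_nonneg _), h5 _ (norm_nonneg _)]
    linarith [two_mul_le_add_sq (‖C (S (f k))‖ ^ p) (‖C (S (e k))‖ ^ p)]
  have hleft := sum_rpow_norm_comp_finiteDiagSqrt_le hδ hd F hC hβ hp hf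
  have hright := sum_rpow_norm_comp_finiteDiagSqrt_le hδ hd F hC hβ hp he'
  calc ∑ i ∈ F, (inner ℂ (δ i) (absPow T p (δ i))).re
      = ∑ i ∈ F, ∑ k, ‖inner ℂ (e k) (δ i)‖ ^ 2 * μ k ^ (p / 2) :=
        Finset.sum_congr rfl fun i hi => inner_eq_sum_of_eigenvectors hpow
          (hexp _ (Submodule.subset_span ⟨i, hi, rfl⟩))
    _ ≤ ∑ k, μ k ^ (p / 2) := by
        rw [Finset.sum_comm]
        refine Finset.sum_le_sum fun k _ => ?_
        rw [← Finset.sum_mul]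
        refine mul_le_of_le_one_left (Real.rpow_nonneg (hμ0 k) _) ?_
        simpa [he.1 k] using sum_norm_inner_sq_le hδ F (e k)
    _ = ∑ k : {k // 0 < μ k}, μ k ^ (p / 2) := by
        classical
        rw [← Finset.sum_subtype (Finset.univ.filter fun k => 0 < μ k) (by simp)
          (fun k => μ k ^ (p / 2))]
        refine (Finset.sum_filter_of_ne fun k _ hk => ?_).symm
        refine (hμ0 k).lt_of_ne fun h0 => hk ?_
        rw [← h0, Real.zero_rpow (by positivity)]
    _ ≤ ∑ k : {k // 0 < μ k}, ((‖C (S (f k))‖ ^ 2) ^ p + (‖C (S (e k))‖ ^ 2) ^ p) / 2 :=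
        Finset.sum_le_sum fun k _ => hbound k
    _ ≤ β ^ (p - 1) * ∑ i ∈ F, d i ^ p * ‖C (δ i)‖ ^ 2 := by
        rw [← Finset.sum_div, Finset.sum_add_distrib]
        linarith

end FiniteRank

/-! ### Spectral measures and the functional calculus -/

section SpectralMeasure

open MeasureTheory

variable {H : Type*} [NormedAddCommGroup H] [InnerProductSpace ℂ H]

theorem realSpectrum_eq (A : H →L[ℂ] H) : realSpectrum A = spectrum ℝ A := by
  ext t
  exact spectrum.algebraMap_mem_iff ℂ (R := ℝ) (a := A) (r := t)

variable [CompleteSpace H]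

theorem isCompact_realSpectrum (A : H →L[ℂ] H) : IsCompact (realSpectrum A) := by
  rw [realSpectrum_eq]
  exact spectrum.isCompact A

theorem integral_spectralMeasure (A : H →L[ℂ] H) (v : H) (f : C_c(ℝ, ℝ)) :
    ∫ t, f t ∂spectralMeasure A v = (inner ℂ v (cfc (f : ℝ → ℝ) A v)).re :=
  RealRMK.integral_rieszMeasure (spectralFunctional A v) f

/-- Regularity gives finiteness on compact sets, hence integrability on the spectrum, and inner
regularity on open sets, hence vanishing off the spectrum. -/
instance (A : H →L[ℂ] H) (v : H) : (spectralMeasure A v).Regular :=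
  RealRMK.regular_rieszMeasure (spectralFunctional A v)

/-- The spectral measure is carried by the spectrum. -/
theorem spectralMeasure_compl_realSpectrum (A : H →L[ℂ] H) (v : H) :
    spectralMeasure A v (realSpectrum A)ᶜ = 0 := by
  have hclosed := (isCompact_realSpectrum A).isClosed
  rw [hclosed.isOpen_compl.measure_eq_iSup_isCompact]
  simp only [ENNReal.iSup_eq_zero]
  intro K hK hKc
  -- A bump `χ` equal to one on `K` and zero on the spectrum bounds the mass of `K` by `⟨v, χ(A) v⟩
  -- = 0`.
  obtain ⟨χ, hχ1, hχ0, hχc, hχ⟩ := exists_continuous_one_zero_of_isCompact hKc hclosed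
    (Set.disjoint_left.2 fun x hx => hK hx)
  have h := RealRMK.rieszMeasure_le_of_eq_one (spectralFunctional A v) (f := ⟨χ, hχc⟩)
    (fun x => (hχ x).1) hKc (fun x hx => hχ1 hx)
  refine le_antisymm (h.trans ?_) zero_le
  have h0 : cfc (χ : ℝ → ℝ) A = 0 := by
    rw [← cfc_zero ℝ A]
    exact cfc_congr fun x hx => hχ0 (by rwa [realSpectrum_eq])
  have h1 : spectralFunctional A v ⟨χ, hχc⟩ = (inner ℂ v (cfc (χ : ℝ → ℝ) A v)).re := rfl
  rw [h1, h0]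
  simp

/-- The spectral measure represents the continuous functional calculus. -/
theorem setIntegral_spectralMeasure (A : H →L[ℂ] H) (v : H) {f : ℝ → ℝ}
    (hf : ContinuousOn f (realSpectrum A)) :
    IntegrableOn f (realSpectrum A) (spectralMeasure A v) ∧
      ∫ t in realSpectrum A, f t ∂spectralMeasure A v = (inner ℂ v (cfc f A v)).re := by
  have hcomp := isCompact_realSpectrum A
  refine ⟨hf.integrableOn_compact hcomp, ?_⟩
  -- Tietze extension followed by a cutoff produces a compactly supported function that agrees with
  -- `f` on the spectrum.
  obtain ⟨g, hg⟩ := ContinuousMap.exists_restrict_eq hcomp.isClosed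
    (⟨(realSpectrum A).domRestrict f, hf.domRestrict⟩ : C(realSpectrum A, ℝ))
  have hg' : ∀ t ∈ realSpectrum A, g t = f t := fun t ht => DFunLike.congr_fun hg ⟨t, ht⟩
  obtain ⟨χ, hχ1, -, hχc, -⟩ := exists_continuous_one_zero_of_isCompact hcomp
    isClosed_empty (Set.disjoint_empty _)
  let k : C_c(ℝ, ℝ) := ⟨g * χ, hχc.mul_left⟩
  have hk : ∀ t ∈ realSpectrum A, k t = f t := fun t ht => by
    have : χ t = 1 := hχ1 ht
    change g t * χ t = f t
    rw [this, mul_one, hg' t ht]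
  have hcfc : cfc f A = cfc (k : ℝ → ℝ) A :=
    cfc_congr fun t ht => (hk t (by rwa [realSpectrum_eq])).symm
  rw [hcfc, ← integral_spectralMeasure, ← setIntegral_congr_fun hcomp.measurableSet hk]
  rw [← Measure.restrict_univ (μ := spectralMeasure A v),
    Measure.restrict_restrict hcomp.measurableSet]
  refine setIntegral_congr_set ?_
  rw [Set.inter_univ]
  exact ae_eq_univ.2 (spectralMeasure_compl_realSpectrum A v)

end SpectralMeasure

/-! ### The resolvent, its modulus and its Borel transform -/

section Resolvent

variable {H : Type*} [NormedAddCommGroup H] [InnerProductSpace ℂ H]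

theorem ofReal_sub_ne_zero {A : H →L[ℂ] H} {z : ℂ} (hz : z ∉ spectrum ℂ A) {t : ℝ}
    (ht : t ∈ realSpectrum A) : (t : ℂ) - z ≠ 0 := fun h =>
  hz (by rw [← sub_eq_zero.1 h]; exact ht)

theorem continuousOn_one_div_ofReal_sub {A : H →L[ℂ] H} {z : ℂ} (hz : z ∉ spectrum ℂ A) :
    ContinuousOn (fun t : ℝ => 1 / ((t : ℂ) - z)) (realSpectrum A) :=
  continuousOn_const.div (by fun_prop) fun _ ht => ofReal_sub_ne_zero hz ht

variable [CompleteSpace H]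

/-- The resolvent in terms of the real functional calculus. -/
theorem resolventOp_eq {A : H →L[ℂ] H} (hA : IsSelfAdjoint A) {z : ℂ} (hz : z ∉ spectrum ℂ A) :
    resolventOp A z = cfc (fun t : ℝ => (1 / ((t : ℂ) - z)).re) A +
      Complex.I • cfc (fun t : ℝ => (1 / ((t : ℂ) - z)).im) A := by
  set X := cfc (fun t : ℝ => (1 / ((t : ℂ) - z)).re) A with hX
  set Y := cfc (fun t : ℝ => (1 / ((t : ℂ) - z)).im) A with hY
  have hc := continuousOn_one_div_ofReal_sub hz
  rw [realSpectrum_eq] at hc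
  have hcr : ContinuousOn (fun t : ℝ => (1 / ((t : ℂ) - z)).re) (spectrum ℝ A) :=
    Complex.continuous_re.comp_continuousOn hc
  have hci : ContinuousOn (fun t : ℝ => (1 / ((t : ℂ) - z)).im) (spectrum ℝ A) :=
    Complex.continuous_im.comp_continuousOn hc
  have hne : ∀ t ∈ spectrum ℝ A, (t : ℂ) - z ≠ 0 := fun t ht =>
    ofReal_sub_ne_zero hz (by rwa [realSpectrum_eq])
  have hone : ∀ t ∈ spectrum ℝ A, ((t : ℂ) - z) * (1 / ((t : ℂ) - z)) = 1 := fun t ht =>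
    mul_one_div_cancel (hne t ht)
  have hAX : A * X = cfc (fun t : ℝ => t * (1 / ((t : ℂ) - z)).re) A := by
    conv_lhs => rw [← cfc_id' ℝ A]
    exact (cfc_mul _ _ A).symm
  have hAY : A * Y = cfc (fun t : ℝ => t * (1 / ((t : ℂ) - z)).im) A := by
    conv_lhs => rw [← cfc_id' ℝ A]
    exact (cfc_mul _ _ A).symm
  -- `hre` and `him` are the real and imaginary parts of `(t - z) r(t) = 1`, transported by the real
  -- functional calculus.
  have hre : A * X - (z.re : ℂ) • X + (z.im : ℂ) • Y = 1 := by
    rw [hAX, hX, hY]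
    simp only [Complex.coe_smul]
    rw [← cfc_const_mul .., ← cfc_const_mul .., ← cfc_sub .., ← cfc_add .., ← cfc_const_one ℝ A]
    refine cfc_congr fun t ht => ?_
    have := congrArg Complex.re (hone t ht)
    simp only [Complex.mul_re, Complex.sub_re, Complex.ofReal_re, Complex.sub_im,
      Complex.ofReal_im, Complex.one_re] at this
    linarith
  have him : A * Y - (z.re : ℂ) • Y - (z.im : ℂ) • X = 0 := by
    rw [hAY, hX, hY]
    simp only [Complex.coe_smul]
    rw [← cfc_const_mul .., ← cfc_const_mul .., ← cfc_sub .., ← cfc_sub .., ← cfc_zero ℝ A]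
    refine cfc_congr fun t ht => ?_
    have := congrArg Complex.im (hone t ht)
    simp only [Complex.mul_im, Complex.sub_re, Complex.ofReal_re, Complex.sub_im,
      Complex.ofReal_im, Complex.one_im] at this
    simp only [Pi.zero_apply]
    linarith
  have hright : (A - z • (1 : H →L[ℂ] H)) * (X + Complex.I • Y) = 1 := by
    have : (A - z • (1 : H →L[ℂ] H)) * (X + Complex.I • Y) =
        (A * X - (z.re : ℂ) • X + (z.im : ℂ) • Y) +
          Complex.I • (A * Y - (z.re : ℂ) • Y - (z.im : ℂ) • X) := by
      conv_lhs => rw [← Complex.re_add_im z]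
      simp only [sub_mul, mul_add, add_mul, mul_smul_comm, smul_mul_assoc, one_mul, add_smul, smul_sub,
        smul_add, smul_smul]
      have : Complex.I * (z.im * Complex.I) = -z.im := by
        rw [mul_left_comm, Complex.I_mul_I]; ring
      rw [this]
      simp only [mul_comm, neg_smul]
      abel
    rw [this, hre, him, smul_zero, add_zero]
  have hcommX : Commute A X := by
    have := cfc_commute_cfc (fun t : ℝ => t) (fun t : ℝ => (1 / ((t : ℂ) - z)).re) A
    rwa [cfc_id' ℝ A] at this
  have hcommY : Commute A Y := by
    have := cfc_commute_cfc (fun t : ℝ => t) (fun t : ℝ => (1 / ((t : ℂ) - z)).im) A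
    rwa [cfc_id' ℝ A] at this
  have hcomm : Commute A (X + Complex.I • Y) := hcommX.add_right (hcommY.smul_right Complex.I)
  have hleft : (X + Complex.I • Y) * (A - z • (1 : H →L[ℂ] H)) = 1 :=
    (hcomm.sub_left ((Commute.one_left _).smul_left z)).eq.symm.trans hright
  exact Ring.inverse_unit (⟨_, _, hright, hleft⟩ : (H →L[ℂ] H)ˣ)

/-- Polar decomposition of the resolvent: it is dominated in the form sense by its modulus. -/
theorem exists_sqrt_abs_resolventOp {A : H →L[ℂ] H} (hA : IsSelfAdjoint A) {z : ℂ}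
    (hz : z ∉ spectrum ℂ A) :
    ∃ C : H →L[ℂ] H, IsSelfAdjoint C ∧ C * C = cfc (fun t : ℝ => ‖1 / ((t : ℂ) - z)‖) A ∧
      ∀ x y, ‖inner ℂ x (resolventOp A z y)‖ ≤ ‖C x‖ * ‖C y‖ := by
  have hc := continuousOn_one_div_ofReal_sub hz
  rw [realSpectrum_eq] at hc
  have hne : ∀ t ∈ spectrum ℝ A, ‖1 / ((t : ℂ) - z)‖ ≠ 0 := fun t ht =>
    norm_ne_zero_iff.2 (one_div_ne_zero (ofReal_sub_ne_zero hz (by rwa [realSpectrum_eq])))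
  set r : ℝ → ℂ := fun t => 1 / ((t : ℂ) - z) with hr
  have hcn : ContinuousOn (fun t => ‖r t‖) (spectrum ℝ A) := hc.norm
  have hcs : ContinuousOn (fun t => √‖r t‖) (spectrum ℝ A) := hcn.sqrt
  have hcu : ContinuousOn (fun t => (r t).re / ‖r t‖) (spectrum ℝ A) :=
    (Complex.continuous_re.comp_continuousOn hc).div hcn hne
  have hcw : ContinuousOn (fun t => (r t).im / ‖r t‖) (spectrum ℝ A) :=
    (Complex.continuous_im.comp_continuousOn hc).div hcn hne
  set C := cfc (fun t => √‖r t‖) A with hC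
  -- `u` and `w` are the real and imaginary parts of the phase `r/|r|`; their commutation gives `U*
  -- U = u² + w² = 1`.
  set u := cfc (fun t => (r t).re / ‖r t‖) A with hu
  set w := cfc (fun t => (r t).im / ‖r t‖) A with hw
  have hCsa : IsSelfAdjoint C := IsSelfAdjoint.cfc
  have husa : IsSelfAdjoint u := IsSelfAdjoint.cfc
  have hwsa : IsSelfAdjoint w := IsSelfAdjoint.cfc
  have hCuC : C * (u * C) = cfc (fun t => (r t).re) A := by
    rw [hC, hu, ← cfc_mul _ _ A hcu hcs, ← cfc_mul _ _ A hcs (ContinuousOn.fun_mul hcu hcs)]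
    refine cfc_congr fun t ht => ?_
    have h0 : ‖r t‖ ≠ 0 := hne t ht
    have h1 : √‖r t‖ * √‖r t‖ = ‖r t‖ := Real.mul_self_sqrt (norm_nonneg _)
    change √‖r t‖ * ((r t).re / ‖r t‖ * √‖r t‖) = (r t).re
    rw [mul_left_comm, h1, div_mul_cancel₀ _ h0]
  have hCwC : C * (w * C) = cfc (fun t => (r t).im) A := by
    rw [hC, hw, ← cfc_mul _ _ A hcw hcs, ← cfc_mul _ _ A hcs (ContinuousOn.fun_mul hcw hcs)]
    refine cfc_congr fun t ht => ?_
    have h0 : ‖r t‖ ≠ 0 := hne t ht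
    have h1 : √‖r t‖ * √‖r t‖ = ‖r t‖ := Real.mul_self_sqrt (norm_nonneg _)
    change √‖r t‖ * ((r t).im / ‖r t‖ * √‖r t‖) = (r t).im
    rw [mul_left_comm, h1, div_mul_cancel₀ _ h0]
  set U : H →L[ℂ] H := u + Complex.I • w with hU
  have hR : resolventOp A z = C * (U * C) := by
    rw [resolventOp_eq hA hz, ← hCuC, ← hCwC, hU]
    simp only [add_mul, mul_add, smul_mul_assoc, mul_smul_comm]
  have huw : u * u + w * w = 1 := by
    rw [hu, hw, ← cfc_mul _ _ A hcu hcu, ← cfc_mul _ _ A hcw hcw,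
      ← cfc_add A _ _ (ContinuousOn.fun_mul hcu hcu) (ContinuousOn.fun_mul hcw hcw), ← cfc_const_one ℝ A]
    refine cfc_congr fun t ht => ?_
    have h0 : ‖r t‖ ≠ 0 := hne t ht
    have h1 : (r t).re * (r t).re + (r t).im * (r t).im = ‖r t‖ ^ 2 := by
      rw [← Complex.normSq_apply, Complex.normSq_eq_norm_sq]
    field_simp
    linarith
  have hcomm : u * w = w * u := (cfc_commute_cfc _ _ A).eq
  have hUU : star U * U = 1 := by
    rw [← huw, hU, star_add, star_smul, husa.star_eq, hwsa.star_eq]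
    simp only [add_mul, mul_add, smul_mul_assoc, mul_smul_comm, hcomm]
    simp [smul_smul]
  have hUn : ∀ y, ‖U y‖ = ‖y‖ := fun y => by
    have h := inner_star_mul_self U y y
    rw [hUU, inner_self_eq_norm_sq_to_K] at h
    simp only [one_apply_eq_self, inner_self_eq_norm_sq_to_K] at h
    have h' : ‖y‖ ^ 2 = ‖U y‖ ^ 2 := by exact_mod_cast h
    exact ((sq_eq_sq₀ (norm_nonneg _) (norm_nonneg _)).1 h').symm
  refine ⟨C, hCsa, ?_, fun x y => ?_⟩
  · rw [hC, ← cfc_mul _ _ A hcs hcs]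
    exact cfc_congr fun t _ => Real.mul_self_sqrt (norm_nonneg _)
  · have h : inner ℂ x (resolventOp A z y) = inner ℂ (C x) (U (C y)) := by
      rw [hR]
      exact (hCsa.isSymmetric x (U (C y))).symm
    rw [h, ← hUn (C y)]
    exact norm_inner_le_norm _ _

/-- `Nontrivial` ensures a nonempty spectrum; the distance to an empty set would take the default
value zero. -/
theorem infDist_spectrum_pos [Nontrivial H] {A : H →L[ℂ] H} {z : ℂ} (hz : z ∉ spectrum ℂ A) :
    0 < Metric.infDist z (spectrum ℂ A) :=
  ((spectrum.isClosed A).notMem_iff_infDist_pos (spectrum.nonempty A)).1 hz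

theorem norm_one_div_ofReal_sub_le [Nontrivial H] {A : H →L[ℂ] H} {z : ℂ}
    (hz : z ∉ spectrum ℂ A) {t : ℝ} (ht : t ∈ realSpectrum A) :
    ‖1 / ((t : ℂ) - z)‖ ≤ (Metric.infDist z (spectrum ℂ A))⁻¹ := by
  rw [norm_div, norm_one, one_div]
  refine inv_anti₀ (infDist_spectrum_pos hz) ?_
  rw [← dist_eq_norm, dist_comm]
  exact Metric.infDist_le_dist_of_mem ht

theorem norm_abs_resolventOp_le [Nontrivial H] {A : H →L[ℂ] H} {z : ℂ}
    (hz : z ∉ spectrum ℂ A) :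
    ‖cfc (fun t : ℝ => ‖1 / ((t : ℂ) - z)‖) A‖ ≤ (Metric.infDist z (spectrum ℂ A))⁻¹ :=
  norm_cfc_le (inv_nonneg.2 Metric.infDist_nonneg) fun t ht => by
    rw [norm_norm]
    exact norm_one_div_ofReal_sub_le hz (by rwa [realSpectrum_eq])

/-- The Borel transform of the spectral measure is the diagonal matrix entry of the resolvent. -/
theorem inner_resolventOp_eq_integral {A : H →L[ℂ] H} (hA : IsSelfAdjoint A) {z : ℂ}
    (hz : z ∉ spectrum ℂ A) (v : H) :
    MeasureTheory.IntegrableOn (fun t : ℝ => 1 / ((t : ℂ) - z)) (realSpectrum A)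
        (spectralMeasure A v) ∧
      inner ℂ v (resolventOp A z v) =
        ∫ t in realSpectrum A, 1 / ((t : ℂ) - z) ∂(spectralMeasure A v) := by
  have hc := continuousOn_one_div_ofReal_sub hz
  have hint := hc.integrableOn_compact (μ := spectralMeasure A v) (isCompact_realSpectrum A)
  refine ⟨hint, ?_⟩
  have hre := (setIntegral_spectralMeasure A v (Complex.continuous_re.comp_continuousOn hc)).2
  have him := (setIntegral_spectralMeasure A v (Complex.continuous_im.comp_continuousOn hc)).2
  have hreal : ∀ f : ℝ → ℝ, ((inner ℂ v (cfc f A v)).re : ℂ) = inner ℂ v (cfc f A v) := fun f =>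
    (IsSelfAdjoint.cfc (f := f) (a := A)).isSymmetric.coe_re_inner_self_apply v
  rw [← integral_re_add_im hint]
  simp only [Function.comp_def] at hre him
  change _ = ((∫ t in realSpectrum A, (1 / ((t : ℂ) - z)).re ∂(spectralMeasure A v) : ℝ) : ℂ) +
    ((∫ t in realSpectrum A, (1 / ((t : ℂ) - z)).im ∂(spectralMeasure A v) : ℝ) : ℂ) * Complex.I
  rw [hre, him, hreal, hreal, resolventOp_eq hA hz, add_apply, smul_apply, inner_add_right,
    inner_smul_right, mul_comm Complex.I]

end Resolvent

/-! ### Norm continuity of operator powers -/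

section AbsPow

open Filter Topology

variable {H : Type*} [NormedAddCommGroup H] [InnerProductSpace ℂ H] [CompleteSpace H]

/-- The operators `T* T` eventually have spectra in one fixed ball, and there the calculus of the
continuous function `x ^ (p/2)` is norm continuous. -/
theorem tendsto_absPow {α : Type*} {l : Filter α} {T : α → H →L[ℂ] H} {T₀ : H →L[ℂ] H}
    (hT : Tendsto T l (𝓝 T₀)) {p : ℝ} (hp : 0 < p) :
    Tendsto (fun a => absPow (T a) p) l (𝓝 (absPow T₀ p)) := by
  simp only [absPow_eq_cfc _ hp]
  have hcont : Continuous fun x : ℝ => x ^ (p / 2) := Real.continuous_rpow_const (by positivity)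
  have hsub : ∀ B : H →L[ℂ] H, ‖B‖ ≤ ‖star T₀ * T₀‖ + 1 →
      spectrum ℝ B ⊆ Metric.closedBall 0 ((‖star T₀ * T₀‖ + 1) * ‖(1 : H →L[ℂ] H)‖) :=
    fun B hB => (spectrum.subset_closedBall_norm_mul B).trans
      (Metric.closedBall_subset_closedBall (by gcongr))
  have hlim : Tendsto (fun a => star (T a) * T a) l (𝓝 (star T₀ * T₀)) := hT.star.mul hT
  refine hlim.cfc (isCompact_closedBall _ _) _ ?_ (.of_forall fun _ => IsSelfAdjoint.star_mul_self _)
    (hsub _ (by linarith)) (IsSelfAdjoint.star_mul_self _) hcont.continuousOn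
  filter_upwards [hlim.norm.eventually_le_const (lt_add_one _)] with a ha using hsub _ ha

theorem isPositive_absPow (T : H →L[ℂ] H) (p : ℝ) : (absPow T p).IsPositive :=
  (ContinuousLinearMap.nonneg_iff_isPositive _).1 CFC.rpow_nonneg

theorem tendsto_re_inner_absPow {α : Type*} {l : Filter α} {T : α → H →L[ℂ] H} {T₀ : H →L[ℂ] H}
    (hT : Tendsto T l (𝓝 T₀)) {p : ℝ} (hp : 0 < p) (v : H) :
    Tendsto (fun a => (inner ℂ v (absPow (T a) p v)).re) l
      (𝓝 (inner ℂ v (absPow T₀ p v)).re) := by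
  have hcont : Continuous fun B : H →L[ℂ] H => (inner ℂ v (B v)).re :=
    Complex.continuous_re.comp (continuous_const.inner (ContinuousLinearMap.apply ℂ H v).continuous)
  exact (hcont.tendsto _).comp (tendsto_absPow hT hp)

theorem isSelfAdjoint_posSqrt (D : H →L[ℂ] H) : IsSelfAdjoint (posSqrt D) :=
  (CFC.sqrt_nonneg D).isSelfAdjoint

theorem posSqrt_apply_of_apply_eq_smul {D : H →L[ℂ] H} (hpos : D.IsPositive) {μ : ℝ} {v : H}
    (hv : D v = (μ : ℂ) • v) : posSqrt D v = (√μ : ℂ) • v := by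
  have hnn : 0 ≤ D := (ContinuousLinearMap.nonneg_iff_isPositive D).2 hpos
  rw [posSqrt, CFC.sqrt_eq_real_sqrt D hnn, cfcₙ_eq_cfc]
  exact cfc_apply_of_apply_eq_smul hpos.isSelfAdjoint Real.continuous_sqrt.continuousOn hv

/-- A nonnegative family with summable `p`-th powers tends to zero. -/
theorem tendsto_cofinite_zero_of_tsum_rpow_ne_top {ι : Type*} {d : ι → ℝ} (hd : ∀ n, 0 ≤ d n)
    {p : ℝ} (hp : 0 < p) (hfin : ∑' n, ENNReal.ofReal (d n ^ p) ≠ ∞) :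
    Tendsto d cofinite (𝓝 0) := by
  have h1 := ENNReal.tendsto_cofinite_zero_of_tsum_ne_top hfin
  have h2 := (ENNReal.tendsto_toReal ENNReal.zero_ne_top).comp h1
  rw [ENNReal.toReal_zero] at h2
  have h3 := ((Real.continuous_rpow_const (q := p⁻¹) (by positivity)).tendsto 0).comp h2
  rw [Real.zero_rpow (by positivity)] at h3
  refine h3.congr fun n => ?_
  simp only [Function.comp_apply]
  rw [ENNReal.toReal_ofReal (Real.rpow_nonneg (hd n) p), ← Real.rpow_mul (hd n),
    mul_inv_cancel₀ hp.ne', Real.rpow_one]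

end AbsPow

/-! ### Diagonal operators on `ℓ²(ℤ)` and passage to the limit -/

section Sequence

open Filter Topology

theorem inner_delta (n : ℤ) (u : Ell2) : inner ℂ (delta n) u = u n := by
  rw [delta, lp.inner_single_left]
  simp

theorem delta_apply (n m : ℤ) : delta n m = if m = n then 1 else 0 := by
  rw [delta, lp.single_apply, Pi.single_apply]

theorem orthonormal_delta : Orthonormal ℂ delta := by
  rw [orthonormal_iff_ite]
  intro i j
  rw [inner_delta, delta_apply]

/-- The entries of a nonnegative diagonal operator. -/
theorem IsDiagonal.exists_entries {D : Ell2 →L[ℂ] Ell2} (hD : IsDiagonal D) (hpos : D.IsPositive) :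
    ∃ d : ℤ → ℝ, (∀ n, 0 ≤ d n) ∧ ∀ n, D (delta n) = (d n : ℂ) • delta n := by
  obtain ⟨c, hc⟩ := hD
  have happ : ∀ n, D (delta n) = c n • delta n := fun n => by
    ext m
    rw [hc, lp.coeFn_smul, Pi.smul_apply, smul_eq_mul, delta_apply]
    split_ifs with h
    · rw [h]
    · simp
  have hinner : ∀ n, inner ℂ (delta n) (D (delta n)) = c n := fun n => by
    rw [inner_delta, hc, delta_apply]
    simp
  refine ⟨fun n => (c n).re, fun n => ?_, fun n => ?_⟩
  · change 0 ≤ (c n).re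
    rw [← hinner]
    exact hpos.re_inner_nonneg_right _
  · have : (((c n).re : ℝ) : ℂ) = c n := by
      rw [← hinner]
      exact hpos.isSelfAdjoint.isSymmetric.coe_re_inner_self_apply (delta n)
    rw [this, happ]

theorem schattenNorm_rpow {p : ℝ} (hp : 0 < p) (T : Ell2 →L[ℂ] Ell2) :
    schattenNorm p T ^ p =
      ∑' n : ℤ, ENNReal.ofReal (inner ℂ (delta n) (absPow T p (delta n))).re := by
  rw [schattenNorm, ← ENNReal.rpow_mul, one_div_mul_cancel hp.ne', ENNReal.rpow_one]

variable {D : Ell2 →L[ℂ] Ell2} {d : ℤ → ℝ}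

theorem schattenNorm_rpow_of_diagonal (hpos : D.IsPositive) (hd : ∀ n, 0 ≤ d n)
    (hD : ∀ n, D (delta n) = (d n : ℂ) • delta n) {p : ℝ} (hp : 0 < p) :
    schattenNorm p D ^ p = ∑' n : ℤ, ENNReal.ofReal (d n ^ p) := by
  rw [schattenNorm_rpow hp]
  refine tsum_congr fun n => ?_
  have hcont : Continuous fun x : ℝ => x ^ (p / 2) := Real.continuous_rpow_const (by positivity)
  have h2 : (star D * D) (delta n) = ((d n ^ 2 : ℝ) : ℂ) • delta n := by
    rw [hpos.isSelfAdjoint.star_eq, mul_apply_eq_comp, hD, map_smul, hD, smul_smul]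
    push_cast
    rw [sq]
  rw [absPow_eq_cfc D hp, cfc_apply_of_apply_eq_smul (IsSelfAdjoint.star_mul_self D)
    hcont.continuousOn h2, inner_smul_right, inner_delta, delta_apply]
  simp only [if_true, mul_one, Complex.ofReal_re]
  rw [← Real.rpow_natCast, ← Real.rpow_mul (hd n)]
  congr 2
  push_cast
  ring

theorem posSqrt_apply (hpos : D.IsPositive) (hD : ∀ n, D (delta n) = (d n : ℂ) • delta n)
    (u : Ell2) (n : ℤ) : posSqrt D u n = √(d n) * u n := by
  rw [← inner_delta, ← inner_delta n u]
  refine ((isSelfAdjoint_posSqrt D).isSymmetric (delta n) u).symm.trans ?_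
  change inner ℂ (posSqrt D (delta n)) u = _
  rw [posSqrt_apply_of_apply_eq_smul hpos (hD n), inner_smul_left, Complex.conj_ofReal]

theorem finiteDiagSqrt_delta_apply (F : Finset ℤ) (u : Ell2) (n : ℤ) :
    finiteDiagSqrt delta d F u n = if n ∈ F then √(d n) * u n else 0 := by
  rw [← inner_delta, finiteDiagSqrt_apply, inner_sum]
  simp only [inner_smul_right, inner_delta, delta_apply]
  simp

/-- Finite truncations of `D^(1/2)` converge in norm when the entries of `D` tend to zero. -/
theorem tendsto_finiteDiagSqrt (hpos : D.IsPositive)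
    (hD : ∀ n, D (delta n) = (d n : ℂ) • delta n) (hlim : Tendsto d cofinite (𝓝 0)) :
    Tendsto (fun F : Finset ℤ => finiteDiagSqrt delta d F) atTop (𝓝 (posSqrt D)) := by
  rw [Metric.tendsto_atTop]
  intro ε hε
  have hsqrt : Tendsto (fun n => √(d n)) cofinite (𝓝 0) := by
    have h := (Real.continuous_sqrt.tendsto 0).comp hlim
    rwa [Real.sqrt_zero] at h
  -- The error is diagonal and lives off `F`; once `F` contains this finite set, its entries are
  -- below `ε / 2`.
  have hfin : {n | ¬ √(d n) < ε / 2}.Finite := hsqrt.eventually_lt_const (half_pos hε)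
  refine ⟨hfin.toFinset, fun F hF => ?_⟩
  rw [dist_eq_norm]
  refine lt_of_le_of_lt (ContinuousLinearMap.opNorm_le_bound _ (half_pos hε).le fun u => ?_)
    (half_lt_self hε)
  have hmono : ‖(finiteDiagSqrt delta d F - posSqrt D) u‖ ≤ ‖((ε / 2 : ℝ) : ℂ) • u‖ := by
    refine lp.norm_mono (by norm_num) fun n => ?_
    rw [sub_apply, lp.coeFn_sub, Pi.sub_apply, finiteDiagSqrt_delta_apply,
      posSqrt_apply hpos hD, lp.coeFn_smul, Pi.smul_apply, norm_smul, Complex.norm_real,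
      Real.norm_of_nonneg (half_pos hε).le]
    split_ifs with h
    · rw [sub_self, norm_zero]; positivity
    · have hn : √(d n) < ε / 2 := by
        by_contra hcon
        exact h (hF (hfin.mem_toFinset.2 hcon))
      rw [zero_sub, norm_neg, norm_mul, Complex.norm_real, Real.norm_of_nonneg (Real.sqrt_nonneg _)]
      gcongr
  rwa [norm_smul, Complex.norm_real, Real.norm_of_nonneg (half_pos hε).le] at hmono

/-- The Schatten bound for `D^(1/2) R D^(1/2)` when the form of `R` is dominated by that of `C²`. -/
theorem tsum_absPow_le (hpos : D.IsPositive) (hd : ∀ n, 0 ≤ d n)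
    (hD : ∀ n, D (delta n) = (d n : ℂ) • delta n) {p : ℝ} (hp : 1 ≤ p)
    (hfin : ∑' n : ℤ, ENNReal.ofReal (d n ^ p) ≠ ∞) {R C : Ell2 →L[ℂ] Ell2}
    (hC : IsSelfAdjoint C) (hR : ∀ x y, ‖inner ℂ x (R y)‖ ≤ ‖C x‖ * ‖C y‖) {β : ℝ}
    (hβ : ‖C‖ ^ 2 ≤ β) :
    ∑' n : ℤ, ENNReal.ofReal
        (inner ℂ (delta n) (absPow (posSqrt D * R * posSqrt D) p (delta n))).re ≤
      ENNReal.ofReal (β ^ (p - 1)) * (∑' n : ℤ, ENNReal.ofReal (d n ^ p)) *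
        ⨆ n : ℤ, ENNReal.ofReal (‖C (delta n)‖ ^ 2) := by
  have hp0 : 0 < p := by linarith
  have hβ0 : 0 ≤ β := (sq_nonneg _).trans hβ
  have hlim := tendsto_cofinite_zero_of_tsum_rpow_ne_top hd hp0 hfin
  have hS := tendsto_finiteDiagSqrt hpos hD hlim
  have hT := (hS.mul_const R).mul hS
  rw [ENNReal.tsum_eq_iSup_sum]
  refine iSup_le fun G => ?_
  -- With `G` fixed only finitely many matrix entries pass to the limit, so continuity of the full
  -- trace is not needed.
  have hterm : Tendsto (fun F : Finset ℤ => ∑ n ∈ G, ENNReal.ofReal (inner ℂ (delta n)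
      (absPow (finiteDiagSqrt delta d F * R * finiteDiagSqrt delta d F) p (delta n))).re) atTop
      (𝓝 (∑ n ∈ G, ENNReal.ofReal
        (inner ℂ (delta n) (absPow (posSqrt D * R * posSqrt D) p (delta n))).re)) := by
    refine tendsto_finsetSum _ fun n _ =>
      ENNReal.tendsto_ofReal (tendsto_re_inner_absPow hT hp0 (delta n))
  refine le_of_tendsto hterm ?_
  filter_upwards [eventually_ge_atTop G] with F hF
  have hnn : ∀ n, 0 ≤ (inner ℂ (delta n)
      (absPow (finiteDiagSqrt delta d F * R * finiteDiagSqrt delta d F) p (delta n))).re :=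
    fun n => (isPositive_absPow _ p).re_inner_nonneg_right _
  calc _ ≤ ∑ n ∈ F, ENNReal.ofReal (inner ℂ (delta n)
        (absPow (finiteDiagSqrt delta d F * R * finiteDiagSqrt delta d F) p (delta n))).re :=
        Finset.sum_le_sum_of_subset hF
    _ = ENNReal.ofReal (∑ n ∈ F, (inner ℂ (delta n)
        (absPow (finiteDiagSqrt delta d F * R * finiteDiagSqrt delta d F) p (delta n))).re) :=
        (ENNReal.ofReal_sum_of_nonneg fun n _ => hnn n).symm
    _ ≤ ENNReal.ofReal (β ^ (p - 1) * ∑ n ∈ F, d n ^ p * ‖C (delta n)‖ ^ 2) :=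
        ENNReal.ofReal_le_ofReal (sum_inner_absPow_le orthonormal_delta hd F hC hR hβ hp)
    _ = ENNReal.ofReal (β ^ (p - 1)) *
          ∑ n ∈ F, ENNReal.ofReal (d n ^ p) * ENNReal.ofReal (‖C (delta n)‖ ^ 2) := by
        have hdp : ∀ n, 0 ≤ d n ^ p := fun n => Real.rpow_nonneg (hd n) p
        rw [ENNReal.ofReal_mul (Real.rpow_nonneg hβ0 _),
          ENNReal.ofReal_sum_of_nonneg fun n _ => mul_nonneg (hdp n) (sq_nonneg _)]
        simp only [ENNReal.ofReal_mul (hdp _)]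
    _ ≤ ENNReal.ofReal (β ^ (p - 1)) * (∑ n ∈ F, ENNReal.ofReal (d n ^ p) *
          ⨆ n : ℤ, ENNReal.ofReal (‖C (delta n)‖ ^ 2)) := by
        gcongr with n
        exact le_iSup (fun n => ENNReal.ofReal (‖C (delta n)‖ ^ 2)) n
    _ ≤ _ := by
        rw [← Finset.sum_mul, ← mul_assoc]
        gcongr
        exact ENNReal.sum_le_tsum F

end Sequence

end JacobiSchatten

end

/-! ### The resolvent formula and the Schatten bound -/

theorem theorem2p1
    (J' D : Ell2 →L[ℂ] Ell2) (p : ℝ) (hp : 1 ≤ p)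
    (hJ : IsJacobi J') (hJsa : IsSelfAdjoint J')
    (hDdiag : IsDiagonal D) (hDnonneg : D.IsPositive) (hD : MemSchatten p D) :
    (∀ (n : ℤ) (z : ℂ), z ∉ spectrum ℂ J' →
      MeasureTheory.IntegrableOn (fun t : ℝ => 1 / ((t : ℂ) - z)) (realSpectrum J')
        (spectralMeasure J' (delta n)) ∧
      inner ℂ (delta n) (resolventOp J' z (delta n)) =
        ∫ t in realSpectrum J', 1 / ((t : ℂ) - z) ∂(spectralMeasure J' (delta n))) ∧
    (∀ z : ℂ, z ∉ spectrum ℂ J' →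
      MemSchatten p (posSqrt D * resolventOp J' z * posSqrt D) ∧
      schattenNorm p (posSqrt D * resolventOp J' z * posSqrt D) ^ p ≤
        ENNReal.ofReal √2 * schattenNorm p D ^ p /
            ENNReal.ofReal (Metric.infDist z (spectrum ℂ J') ^ (p - 1)) *
          ⨆ n : ℤ, ∫⁻ t in realSpectrum J', ENNReal.ofReal (1 / ‖(t : ℂ) - z‖)
            ∂(spectralMeasure J' (delta n))) := by
  have hp0 : 0 < p := by linarith
  refine ⟨fun n z hz => inner_resolventOp_eq_integral hJsa hz (delta n), fun z hz => ?_⟩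
  have : Nontrivial Ell2 := ⟨delta 0, 0, orthonormal_delta.ne_zero 0⟩
  obtain ⟨d, hd0, hd⟩ := hDdiag.exists_entries hDnonneg
  obtain ⟨C, hCsa, hCC, hCR⟩ := exists_sqrt_abs_resolventOp hJsa hz
  have hdist := infDist_spectrum_pos hz
  set ρ := Metric.infDist z (spectrum ℂ J') with hρ
  have hCnorm : ‖C‖ ^ 2 ≤ ρ⁻¹ := by
    rw [← hCsa.norm_mul_self, hCC]
    exact norm_abs_resolventOp_le hz
  have hDp : schattenNorm p D ^ p ≠ ∞ := ENNReal.rpow_ne_top_of_nonneg hp0.le hD.ne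
  have hDeq := schattenNorm_rpow_of_diagonal hDnonneg hd0 hd hp0
  -- Both sides equal `⟨δ_n, C² δ_n⟩`, since `C²` is the function `1/|t - z|` of `J'`.
  have hL : ∀ n : ℤ, ∫⁻ t in realSpectrum J', ENNReal.ofReal (1 / ‖(t : ℂ) - z‖)
      ∂(spectralMeasure J' (delta n)) = ENNReal.ofReal (‖C (delta n)‖ ^ 2) := fun n => by
    obtain ⟨hint, heq⟩ := setIntegral_spectralMeasure J' (delta n)
      (continuousOn_one_div_ofReal_sub hz).norm
    have hC2 : ‖C (delta n)‖ ^ 2 = (inner ℂ (delta n) ((C * C) (delta n))).re := by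
      have h := inner_star_mul_self C (delta n) (delta n)
      rw [hCsa.star_eq] at h
      rw [h]
      exact norm_sq_eq_re_inner (𝕜 := ℂ) _
    rw [hC2, hCC, ← heq, MeasureTheory.ofReal_integral_eq_lintegral_ofReal hint
      (.of_forall fun _ => norm_nonneg _)]
    simp
  simp only [hL]
  have hmain := tsum_absPow_le hDnonneg hd0 hd hp (hDeq ▸ hDp) hCsa hCR hCnorm
  rw [← schattenNorm_rpow hp0, ← hDeq] at hmain
  refine ⟨?_, hmain.trans ?_⟩
  · have hsup : (⨆ n : ℤ, ENNReal.ofReal (‖C (delta n)‖ ^ 2)) ≤ ENNReal.ofReal ρ⁻¹ := by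
      refine iSup_le fun n => ENNReal.ofReal_le_ofReal (le_trans ?_ hCnorm)
      have := C.le_opNorm (delta n)
      rw [orthonormal_delta.1 n, mul_one] at this
      gcongr
    have hlt : schattenNorm p (posSqrt D * resolventOp J' z * posSqrt D) ^ p < ∞ :=
      hmain.trans_lt (ENNReal.mul_lt_top (ENNReal.mul_lt_top ENNReal.ofReal_lt_top hDp.lt_top)
        (hsup.trans_lt ENNReal.ofReal_lt_top))
    exact (ENNReal.rpow_lt_top_iff_of_pos hp0).1 hlt
  · gcongr
    rw [Real.inv_rpow hdist.le, ENNReal.ofReal_inv_of_pos (Real.rpow_pos_of_pos hdist _),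
      ENNReal.div_eq_inv_mul]
    gcongr
    -- The estimate already holds with constant one; `√2` enters only through `1 ≤ √2`.
    refine le_mul_of_one_le_left' ?_
    rw [ENNReal.one_le_ofReal]
    exact Real.one_le_sqrt.2 (by norm_num)
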